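/- **Theorem 1.3.** Let $I=[0,1]$ with the Euclidean metric $\varrho$. For a continuous map $f:I\to I$, $x\in I$, $\varepsilon>0$, $n\ge1$ and $m\in\{1,2,\dots\}\cup\{\infty\}$, let $\varrho_m(y,z)=\sup\{\varrho(f^i(y),f^i(z)):0\le i<m\}$, $$C_m(x,n,\varepsilon)=\frac1{n^2}\,\#\{(i,j):0\le i,j<n,\ \varrho_m(f^i(x),f^j(x))\le\varepsilon\},$$ and let $$\underline{\mathrm{rdet}}_\infty(x,\varepsilon)=\liminf_{n\to\infty}\frac{C_\infty(x,n,\varepsilon)}{C_1(x,n,\varepsilon)},\qquad \overline{\mathrm{rdet}}_\infty(x,\varepsilon)=\limsup_{n\to\infty}\frac{C_\infty(x,n,\varepsilon)}{C_1(x,n,\varepsilon)};$$ if these two numbers coincide, $\mathrm{rdet}_\infty(x,\varepsilon)$ exists and denotes their common value. The map $f$ is Li-Yorke chaotic if there is an uncountable set $S\subseteq I$ such that $\liminf_n\varrho(f^n(y),f^n(z))=0$ and $\limsup_n\varrho(f^n(y),f^n(z))>0$ for all distinct $y,z\in S$. It is of type $2^\infty$ if the set of least periods of its periodic points is exactly $\{2^n:n\ge0\}$.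 A minimal set of $f$ is a nonempty closed set $M\subseteq I$ with $f(M)\subseteq M$ having no proper subset with the same properties. There are a continuous map $f:I\to I$ which is of type $2^\infty$, is not Li-Yorke chaotic and has exactly one infinite minimal set $C$, and sequences $(\varepsilon_k)_k$, $(\varepsilon'_k)_k$ of positive reals strictly decreasing to $0$, such that for every $x\in C$ $$\mathrm{rdet}_\infty(x,\varepsilon_k)\text{ exists and equals }1\text{ for every }k,\qquad\text{and}\qquad \lim_{k\to\infty}\overline{\mathrm{rdet}}_\infty(x,\varepsilon'_k)=0.$$ Consequently, for every $x\in C$, $$\limsup_{\varepsilon\to0^+}\underline{\mathrm{rdet}}_\infty(x,\varepsilon)=1\qquad\text{and}\qquad\liminf_{\varepsilon\to0^+}\overline{\mathrm{rdet}}_\infty(x,\varepsilon)=0.$$ -/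

import Mathlib

open Filter Topology

namespace RecDet

noncomputable section

/-- The pair `(y, z)` is scrambled for `f`: `liminf ϱ(fⁿ y, fⁿ z) = 0` and
`limsup ϱ(fⁿ y, fⁿ z) > 0`. (In a compact space the distances are bounded, so these are the
usual lower and upper limits.) -/
def IsScrambledPair {X : Type*} [MetricSpace X] (f : X → X) (y z : X) : Prop :=
  liminf (fun n : ℕ => dist (f^[n] y) (f^[n] z)) atTop = 0 ∧
    0 < limsup (fun n : ℕ => dist (f^[n] y) (f^[n] z)) atTop

/-- A set is scrambled if any two distinct points of it form a scrambled pair. -/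
def IsScrambledSet {X : Type*} [MetricSpace X] (f : X → X) (S : Set X) : Prop :=
  ∀ y ∈ S, ∀ z ∈ S, y ≠ z → IsScrambledPair f y z

/-- `f` is Li-Yorke chaotic: there is an uncountable scrambled set. -/
def IsLiYorkeChaotic {X : Type*} [MetricSpace X] (f : X → X) : Prop :=
  ∃ S : Set X, ¬ S.Countable ∧ IsScrambledSet f S

/-- The set of (least) periods of the periodic points of `f`. -/
def periods {X : Type*} (f : X → X) : Set ℕ :=
  {p | 0 < p ∧ ∃ x, Function.minimalPeriod f x = p}

/-- `f` is of type `2^∞` (in the Sharkovsky order): the periods of `f` are exactly the powers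
`1, 2, 4, 8, …` of two. -/
def IsOfTypeTwoInfty {X : Type*} (f : X → X) : Prop :=
  periods f = {p | ∃ n : ℕ, p = 2 ^ n}

/-- `M` is a minimal set of `f`: a nonempty closed set with `f(M) ⊆ M` which has no proper subset
with these properties. -/
def IsMinimalSet {X : Type*} [TopologicalSpace X] (f : X → X) (M : Set X) : Prop :=
  M.Nonempty ∧ IsClosed M ∧ Set.MapsTo f M M ∧
    ∀ N : Set X, N ⊆ M → N.Nonempty → IsClosed N → Set.MapsTo f N N → N = M

/-- Bowen's metric `ϱ_m(x, y) = sup {ϱ(fⁱ x, fⁱ y) : 0 ≤ i < m}` for `1 ≤ m ≤ ∞`. -/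
def bowenDist {X : Type*} [MetricSpace X] (f : X → X) (m : ℕ∞) (x y : X) : ℝ :=
  ⨆ i : {i : ℕ // (i : ℕ∞) < m}, dist (f^[i] x) (f^[i] y)

open Classical in
/-- The correlation sum `C_m(x, n, ε)` with respect to Bowen's metric `ϱ_m`, `1 ≤ m ≤ ∞`:
the number of pairs `(i, j)` with `0 ≤ i, j < n` and `ϱ_m(fⁱ x, fʲ x) ≤ ε`, divided by `n²`.
For `m = ∞` this is the limit of the sums for finite `m`, see `tendsto_corrSum`. -/
def corrSum {X : Type*} [MetricSpace X] (f : X → X) (m : ℕ∞) (x : X) (n : ℕ) (ε : ℝ) : ℝ :=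
  (((Finset.range n ×ˢ Finset.range n).filter
    (fun p : ℕ × ℕ => bowenDist f m (f^[p.1] x) (f^[p.2] x) ≤ ε)).card : ℝ) / (n : ℝ) ^ 2

/-- The recurrence `m`-determinism `C_m(x, n, ε) / C_1(x, n, ε)` of the first `n` iterates. -/
def rdet {X : Type*} [MetricSpace X] (f : X → X) (m : ℕ∞) (x : X) (n : ℕ) (ε : ℝ) : ℝ :=
  corrSum f m x n ε / corrSum f 1 x n ε

/-- The lower asymptotic recurrence `m`-determinism at `x`. -/
def lowerRdet {X : Type*} [MetricSpace X] (f : X → X) (m : ℕ∞) (x : X) (ε : ℝ) : ℝ :=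
  liminf (fun n : ℕ => rdet f m x n ε) atTop

/-- The upper asymptotic recurrence `m`-determinism at `x`. -/
def upperRdet {X : Type*} [MetricSpace X] (f : X → X) (m : ℕ∞) (x : X) (ε : ℝ) : ℝ :=
  limsup (fun n : ℕ => rdet f m x n ε) atTop

/-- The recurrence `m`-determinism at `x` exists and equals `c`: the lower and the upper
asymptotic recurrence `m`-determinism are both equal to `c`. -/
def RdetExistsEq {X : Type*} [MetricSpace X] (f : X → X) (m : ℕ∞) (x : X) (ε c : ℝ) : Prop :=
  lowerRdet f m x ε = c ∧ upperRdet f m x ε = c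

theorem bowenDist_le_iff {X : Type*} [MetricSpace X] [CompactSpace X] (f : X → X) (m : ℕ∞)
    (hm : 1 ≤ m) (x y : X) (ε : ℝ) :
    bowenDist f m x y ≤ ε ↔ ∀ i : ℕ, (i : ℕ∞) < m → dist (f^[i] x) (f^[i] y) ≤ ε := by
  have : Nonempty {i : ℕ // (i : ℕ∞) < m} :=
    ⟨⟨0, by simpa using lt_of_lt_of_le zero_lt_one hm⟩⟩
  have hb : BddAbove (Set.range fun i : {i : ℕ // (i : ℕ∞) < m} =>
      dist (f^[i] x) (f^[i] y)) := by
    refine ⟨Metric.diam (Set.univ : Set X), ?_⟩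
    rintro _ ⟨i, rfl⟩
    exact Metric.dist_le_diam_of_mem isCompact_univ.isBounded (Set.mem_univ _) (Set.mem_univ _)
  unfold bowenDist
  rw [ciSup_le_iff hb]
  simp

/-- `C_∞(x, n, ε)` is the limit of `C_m(x, n, ε)` as `m → ∞`. -/
theorem tendsto_corrSum {X : Type*} [MetricSpace X] [CompactSpace X] (f : X → X) (x : X) (n : ℕ)
    (ε : ℝ) :
    Tendsto (fun m : ℕ => corrSum f (m : ℕ∞) x n ε) atTop (𝓝 (corrSum f ⊤ x n ε)) := by
  classical
  apply tendsto_const_nhds.congr'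
  have key : ∀ p ∈ Finset.range n ×ˢ Finset.range n, ∀ᶠ m : ℕ in atTop,
      (bowenDist f ⊤ (f^[p.1] x) (f^[p.2] x) ≤ ε ↔
        bowenDist f (m : ℕ∞) (f^[p.1] x) (f^[p.2] x) ≤ ε) := by
    intro p _
    by_cases h : bowenDist f ⊤ (f^[p.1] x) (f^[p.2] x) ≤ ε
    · filter_upwards [eventually_ge_atTop 1] with m hm
      refine ⟨fun _ => ?_, fun _ => h⟩
      rw [bowenDist_le_iff f ⊤ le_top] at h
      rw [bowenDist_le_iff f m (by exact_mod_cast hm)]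
      exact fun i _ => h i (ENat.natCast_lt_top i)
    · have h' := h
      rw [bowenDist_le_iff f ⊤ le_top] at h'
      push Not at h'
      obtain ⟨i, _, hi⟩ := h'
      filter_upwards [eventually_ge_atTop (i + 1)] with m hm
      refine ⟨fun h2 => absurd h2 h, fun h2 => ?_⟩
      rw [bowenDist_le_iff f m (by exact_mod_cast (by omega : 1 ≤ m))] at h2
      exact absurd (h2 i (by exact_mod_cast hm)) (not_le.mpr hi)
  filter_upwards [(Finset.eventually_all _).mpr key] with m hm
  unfold corrSum
  congr 2
  convert congrArg Finset.card (Finset.filter_congr hm)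

end

end RecDet

/-! The map is infinitely renormalizable, with unequal ratios. Two disjoint copies of the space,
`left n` of ratio `a n` and `right n` of ratio `b n ≤ a n`, are exchanged by `map n`, whose square
on the left copy is a copy of `map (n + 1)`; all other orbits land on a fixed point or enter the
copies. Iterating this, the periods are powers of two, proximal pairs are asymptotic, and the only
infinite minimal set is the intersection of the nested copies, the solenoid.

On the solenoid an orbit visits the `2 ^ (m + 1)` pieces of level `m + 1` cyclically, so everything
depends on differences of times. Times congruent modulo `2 ^ (m + 1)` stay within `a m` forever
(`dist_le_of_dvd`). Incongruent ones are at distance at least `(1/3) ∏ b l`, `l < m`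
(`le_dist_of_not_dvd`), and at some later time at least `(1/3) ∏ a l`, `l < m`
(`exists_le_dist_of_not_dvd`).

If `a m < (1/3) ∏ b l` over `l < m`, then closeness at scale `a m` is congruence, hence persists:
the determinism is 1. At scale `b m` some piece of level `m + 1` has diameter at most `b m`, so
`C_1` is at least of order `4 ^ (-m)`. If `b m < (1/3) ∏ a l` over `l < M`, then closeness for all
times forces congruence modulo `2 ^ (M + 1)`, so `C_∞` is at most of order `2 ^ (-M)`. With `M = 3 *
m` the quotient tends to 0.

Both inequalities hold for `m = 4 ^ k` when `b n = 3 ^ (-2 * 8 ^ n)` and `a n` is `1/3` except that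
`a n = 3 ^ (-8 ^ n)` at powers of four. On `[0, 1]` the tower is built by solving the
renormalization equation as a series (`towerMap`). -/

namespace RecDet

/-- A sequence of maps `map n` of a metric space such that the square of `map n`, restricted to a
small copy `Set.range (left n)` of the space, is a copy of `map (n + 1)`, and such that
every orbit of `map n` either lands on a fixed point or enters this copy. -/
structure DoublingTower (X : Type*) [MetricSpace X] where
  /-- the maps -/
  map : ℕ → X → X
  /-- the embedding onto the first copy -/
  left : ℕ → X → X
  /-- the embedding onto the second copy -/
  right : ℕ → X → X
  /-- the ratio of `left` -/
  a : ℕ → ℝ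
  /-- the ratio of `right` -/
  b : ℕ → ℝ
  /-- the fixed point outside of both copies -/
  fix : ℕ → X
  /-- a point of the solenoid -/
  base : X
  b_pos : ∀ n, 0 < b n
  b_le_a : ∀ n, b n ≤ a n
  a_le : ∀ n, a n ≤ 1 / 3
  dist_le_one : ∀ x y : X, dist x y ≤ 1
  continuous_map : ∀ n, Continuous (map n)
  dist_left : ∀ n x y, dist (left n x) (left n y) = a n * dist x y
  dist_right : ∀ n x y, dist (right n x) (right n y) = b n * dist x y
  dist_left_right : ∀ n x y, 1 / 3 ≤ dist (left n x) (right n y)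
  map_left : ∀ n x, map n (left n x) = right n (map (n + 1) x)
  map_right : ∀ n x, map n (right n x) = left n x
  map_fix : ∀ n, map n (fix n) = fix n
  fix_separated : ∀ n, ∃ δ > 0, ∀ x, δ ≤ dist (fix n) (left n x) ∧ δ ≤ dist (fix n) (right n x)
  exists_iterate : ∀ n x, ∃ k, (map n)^[k] x = fix n ∨ (map n)^[k] x ∈ Set.range (left n)
  left_base : ∀ n, left n base = base

namespace DoublingTower

/-! ### Injectivity of the copies and iteration through them. -/

variable {X : Type*} [MetricSpace X] (T : DoublingTower X)

theorem a_pos (n : ℕ) : 0 < T.a n := (T.b_pos n).trans_le (T.b_le_a n)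

theorem a_le_one (n : ℕ) : T.a n ≤ 1 := (T.a_le n).trans (by norm_num)

theorem left_injective (n : ℕ) : Function.Injective (T.left n) := by
  intro x y h
  have h1 := T.dist_left n x y
  rw [h, dist_self, eq_comm, mul_eq_zero] at h1
  exact dist_eq_zero.1 (h1.resolve_left (T.a_pos n).ne')

theorem left_ne_right (n : ℕ) (x y : X) : T.left n x ≠ T.right n y := by
  intro h
  have h1 := T.dist_left_right n x y
  rw [h, dist_self] at h1
  norm_num at h1

theorem continuous_left (n : ℕ) : Continuous (T.left n) :=
  (LipschitzWith.of_dist_le_mul (K := ⟨T.a n, (T.a_pos n).le⟩)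
    fun x y => (T.dist_left n x y).le).continuous

theorem continuous_right (n : ℕ) : Continuous (T.right n) :=
  (LipschitzWith.of_dist_le_mul (K := ⟨T.b n, (T.b_pos n).le⟩)
    fun x y => (T.dist_right n x y).le).continuous

theorem iterate_even_left (n k : ℕ) (x : X) :
    (T.map n)^[2 * k] (T.left n x) = T.left n ((T.map (n + 1))^[k] x) := by
  induction k generalizing x with
  | zero => rfl
  | succ k ih =>
    rw [show 2 * (k + 1) = 2 * k + 1 + 1 by ring, Function.iterate_succ_apply,
      Function.iterate_succ_apply, T.map_left, T.map_right, ih, Function.iterate_succ_apply]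

theorem iterate_odd_left (n k : ℕ) (x : X) :
    (T.map n)^[2 * k + 1] (T.left n x) = T.right n ((T.map (n + 1))^[k + 1] x) := by
  rw [Function.iterate_succ_apply', T.iterate_even_left, T.map_left, Function.iterate_succ_apply']

theorem iterate_odd_right (n k : ℕ) (x : X) :
    (T.map n)^[2 * k + 1] (T.right n x) = T.left n ((T.map (n + 1))^[k] x) := by
  rw [Function.iterate_succ_apply, T.map_right, T.iterate_even_left]

theorem iterate_even_right (n k : ℕ) (x : X) :
    (T.map n)^[2 * k] (T.right n x) = T.right n ((T.map (n + 1))^[k] x) := by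
  cases k with
  | zero => rfl
  | succ k =>
    rw [show 2 * (k + 1) = 2 * k + 1 + 1 by ring, Function.iterate_succ_apply, T.map_right,
      T.iterate_odd_left]

/-! ### Periods -/

theorem minimalPeriod_left (n : ℕ) (x : X) :
    Function.minimalPeriod (T.map n) (T.left n x) =
      2 * Function.minimalPeriod (T.map (n + 1)) x := by
  apply Nat.dvd_antisymm
  · rw [← Function.isPeriodicPt_iff_minimalPeriod_dvd, Function.IsPeriodicPt,
      Function.IsFixedPt, T.iterate_even_left, Function.iterate_minimalPeriod]
  · have h := Function.iterate_minimalPeriod (f := T.map n) (x := T.left n x)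
    obtain ⟨k, hk⟩ := Nat.even_or_odd' (Function.minimalPeriod (T.map n) (T.left n x))
    rcases hk with hk | hk
    · rw [hk] at h ⊢
      rw [T.iterate_even_left] at h
      exact Nat.mul_dvd_mul_left 2
        (Function.isPeriodicPt_iff_minimalPeriod_dvd.1 (T.left_injective n h))
    -- An odd number of steps ends in the right copy, which is disjoint from the left one.
    · rw [hk, T.iterate_odd_left] at h
      exact absurd h.symm (T.left_ne_right n _ _)

theorem exists_minimalPeriod_eq (k n : ℕ) :
    ∃ x, Function.minimalPeriod (T.map n) x = 2 ^ k := by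
  induction k generalizing n with
  | zero => exact ⟨T.fix n, by simpa using Function.minimalPeriod_eq_one_iff_isFixedPt.2 (T.map_fix n)⟩
  | succ k ih =>
    obtain ⟨x, hx⟩ := ih (n + 1)
    exact ⟨T.left n x, by rw [T.minimalPeriod_left, hx, pow_succ, mul_comm]⟩

/-- A cycle that is not the fixed point meets the left copy, where it is a cycle of the next map of
half the length; hence descent on `p`. -/
theorem minimalPeriod_eq_two_pow (p : ℕ) (hp : 0 < p) (n : ℕ) (x : X)
    (hx : Function.minimalPeriod (T.map n) x = p) : ∃ k, p = 2 ^ k := by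
  induction p using Nat.strong_induction_on generalizing n x with
  | _ p ih =>
    have hper : x ∈ Function.periodicPts (T.map n) :=
      Function.minimalPeriod_pos_iff_mem_periodicPts.1 (hx ▸ hp)
    obtain ⟨k, hk⟩ := T.exists_iterate n x
    have hk' := Function.minimalPeriod_apply_iterate hper k
    rcases hk with hk | ⟨y, hy⟩
    · rw [hk, Function.minimalPeriod_eq_one_iff_isFixedPt.2 (T.map_fix n)] at hk'
      exact ⟨0, by rw [← hx, ← hk', pow_zero]⟩
    · rw [← hy, T.minimalPeriod_left, hx] at hk'
      obtain ⟨j, hj⟩ := ih _ (by omega) (by omega) (n + 1) y rfl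
      exact ⟨j + 1, by rw [← hk', hj, pow_succ, mul_comm]⟩

theorem isOfTypeTwoInfty (n : ℕ) : IsOfTypeTwoInfty (T.map n) := by
  ext p
  constructor
  · rintro ⟨hp, x, hx⟩
    exact T.minimalPeriod_eq_two_pow p hp n x hx
  · rintro ⟨k, rfl⟩
    exact ⟨by positivity, T.exists_minimalPeriod_eq k n⟩

/-! ### Absence of scrambled pairs -/

theorem eventually_fix_or_left (n : ℕ) (x : X) :
    ∃ K, (∀ t, (T.map n)^[K + t] x = T.fix n) ∨
      ∃ y, ∀ t, (T.map n)^[K + t] x = (T.map n)^[t] (T.left n y) := by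
  obtain ⟨K, hK⟩ := T.exists_iterate n x
  refine ⟨K, hK.imp (fun h t => ?_) fun ⟨y, hy⟩ => ⟨y, fun t => ?_⟩⟩
  · rw [add_comm, Function.iterate_add_apply, h]
    exact Function.iterate_fixed (T.map_fix n) t
  · rw [add_comm, Function.iterate_add_apply, hy]

/-- The pair `(x, y)` is proximal for `map n`. -/
def Proximal (n : ℕ) (x y : X) : Prop :=
  ∀ ε > 0, ∀ N, ∃ k ≥ N, dist ((T.map n)^[k] x) ((T.map n)^[k] y) < ε

theorem Proximal.symm {T : DoublingTower X} {n : ℕ} {x y : X} (h : T.Proximal n x y) :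
    T.Proximal n y x := fun ε hε N => by
  simpa only [dist_comm] using h ε hε N

theorem not_proximal_fix_left {n : ℕ} {x y z : X} {K L : ℕ}
    (hx : ∀ t, (T.map n)^[K + t] x = T.fix n)
    (hy : ∀ t, (T.map n)^[L + t] y = (T.map n)^[t] (T.left n z)) : ¬ T.Proximal n x y := by
  intro h
  obtain ⟨δ, hδ, hs⟩ := T.fix_separated n
  obtain ⟨k, hk, hd⟩ := h δ hδ (K + L)
  have h1 := hx (k - K)
  have h2 := hy (k - L)
  rw [show K + (k - K) = k by omega] at h1
  rw [show L + (k - L) = k by omega] at h2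
  rw [h1, h2] at hd
  obtain ⟨j, hj | hj⟩ := Nat.even_or_odd' (k - L)
  · rw [hj, T.iterate_even_left] at hd
    exact absurd hd (not_lt.2 (hs _).1)
  · rw [hj, T.iterate_odd_left] at hd
    exact absurd hd (not_lt.2 (hs _).2)

/-- Proximal pairs are asymptotic: two orbits in the copies must enter the same copy simultaneously,
which renormalizes them to a proximal pair of the next map and gains a factor `1/3` per level. -/
theorem Proximal.eventually_dist_le {T : DoublingTower X} {n : ℕ} {x y : X}
    (h : T.Proximal n x y) (m : ℕ) :
    ∃ N, ∀ k ≥ N, dist ((T.map n)^[k] x) ((T.map n)^[k] y) ≤ (1 / 3) ^ m := by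
  induction m generalizing n x y with
  | zero => exact ⟨0, fun k _ => by simpa using T.dist_le_one _ _⟩
  | succ m ih =>
    obtain ⟨K, hx⟩ := T.eventually_fix_or_left n x
    obtain ⟨L, hy⟩ := T.eventually_fix_or_left n y
    rcases hx with hx | ⟨x', hx⟩ <;> rcases hy with hy | ⟨y', hy⟩
    · refine ⟨K + L, fun k hk => ?_⟩
      have h1 := hx (k - K)
      have h2 := hy (k - L)
      rw [show K + (k - K) = k by omega] at h1
      rw [show L + (k - L) = k by omega] at h2
      rw [h1, h2, dist_self]
      positivity
    · exact absurd h (T.not_proximal_fix_left hx hy)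
    · exact absurd h.symm (T.not_proximal_fix_left hy hx)
    · by_cases hp : K % 2 = L % 2
      -- A common starting time `M = K + 2 * d`, past both `K` and `L` and of their parity: both
      -- points are then in the left copy.
      · obtain ⟨d, hd⟩ : ∃ d, K + L = K + 2 * d ∨ K + L + 1 = K + 2 * d := ⟨(L + 1) / 2, by omega⟩
        obtain ⟨e, he⟩ : ∃ e, K + 2 * d = L + 2 * e := ⟨(K + 2 * d - L) / 2, by omega⟩
        have hd1 : ∀ t, (T.map n)^[K + 2 * d + t] x =
            (T.map n)^[t] (T.left n ((T.map (n + 1))^[d] x')) := fun t => by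
          rw [add_assoc, hx, add_comm, Function.iterate_add_apply, T.iterate_even_left]
        have hd2 : ∀ t, (T.map n)^[K + 2 * d + t] y =
            (T.map n)^[t] (T.left n ((T.map (n + 1))^[e] y')) := fun t => by
          rw [he, add_assoc, hy, add_comm, Function.iterate_add_apply, T.iterate_even_left]
        generalize (T.map (n + 1))^[d] x' = u at hd1
        generalize (T.map (n + 1))^[e] y' = v at hd2
        generalize K + 2 * d = M at hd1 hd2
        have key : ∀ t, ∃ c, T.b n ≤ c ∧ c ≤ 1 / 3 ∧
            dist ((T.map n)^[M + t] x) ((T.map n)^[M + t] y) =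
              c * dist ((T.map (n + 1))^[(t + 1) / 2] u) ((T.map (n + 1))^[(t + 1) / 2] v) := by
          intro t
          rw [hd1, hd2]
          obtain ⟨i, rfl | rfl⟩ := Nat.even_or_odd' t
          · refine ⟨T.a n, T.b_le_a n, T.a_le n, ?_⟩
            rw [T.iterate_even_left, T.iterate_even_left, T.dist_left,
              show (2 * i + 1) / 2 = i by omega]
          · refine ⟨T.b n, le_rfl, (T.b_le_a n).trans (T.a_le n), ?_⟩
            rw [T.iterate_odd_left, T.iterate_odd_left, T.dist_right,
              show (2 * i + 1 + 1) / 2 = i + 1 by omega]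
        have hprox : T.Proximal (n + 1) u v := by
          intro ε hε N
          obtain ⟨k, hk, hlt⟩ := h (T.b n * ε) (mul_pos (T.b_pos n) hε) (M + 2 * N)
          obtain ⟨c, hc, -, hc'⟩ := key (k - M)
          rw [show M + (k - M) = k by omega] at hc'
          refine ⟨(k - M + 1) / 2, by omega, ?_⟩
          rw [hc'] at hlt
          exact lt_of_mul_lt_mul_left
            ((mul_le_mul_of_nonneg_right hc dist_nonneg).trans_lt hlt) (T.b_pos n).le
        obtain ⟨N, hN⟩ := ih hprox
        refine ⟨M + 2 * N, fun k hk => ?_⟩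
        obtain ⟨c, -, hc, hc'⟩ := key (k - M)
        rw [show M + (k - M) = k by omega] at hc'
        rw [hc', pow_succ']
        exact mul_le_mul hc (hN _ (by omega)) dist_nonneg (by norm_num)
      -- With opposite parities the orbits are always in opposite copies, at distance at least
      -- `1/3`.
      · obtain ⟨k, hk, hd⟩ := h (1 / 3) (by norm_num) (K + L)
        have h1 := hx (k - K)
        have h2 := hy (k - L)
        rw [show K + (k - K) = k by omega] at h1
        rw [show L + (k - L) = k by omega] at h2
        rw [h1, h2] at hd
        obtain ⟨i, hi | hi⟩ := Nat.even_or_odd' (k - K) <;>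
          obtain ⟨j, hj | hj⟩ := Nat.even_or_odd' (k - L)
        · omega
        · rw [hi, hj, T.iterate_even_left, T.iterate_odd_left] at hd
          exact absurd hd (not_lt.2 (T.dist_left_right _ _ _))
        · rw [hi, hj, T.iterate_even_left, T.iterate_odd_left, dist_comm] at hd
          exact absurd hd (not_lt.2 (T.dist_left_right _ _ _))
        · omega

theorem not_isScrambledPair (n : ℕ) (x y : X) : ¬ IsScrambledPair (T.map n) x y := by
  rintro ⟨h0, hpos⟩
  have hprox : T.Proximal n x y := by
    intro ε hε N
    have hlt : liminf (fun k : ℕ => dist ((T.map n)^[k] x) ((T.map n)^[k] y)) atTop < ε := by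
      rwa [h0]
    have hcob : IsCoboundedUnder (· ≥ ·) atTop
        fun k : ℕ => dist ((T.map n)^[k] x) ((T.map n)^[k] y) :=
      (isBoundedUnder_of ⟨1, fun k => T.dist_le_one _ _⟩ :
        IsBoundedUnder (· ≤ ·) atTop _).isCoboundedUnder_ge
    exact frequently_atTop.1 (frequently_lt_of_liminf_lt hcob hlt) N
  obtain ⟨m, hm⟩ := exists_pow_lt_of_lt_one hpos (by norm_num : (1 / 3 : ℝ) < 1)
  obtain ⟨N, hN⟩ := hprox.eventually_dist_le m
  have hcob : IsCoboundedUnder (· ≤ ·) atTop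
      fun k : ℕ => dist ((T.map n)^[k] x) ((T.map n)^[k] y) :=
    (isBoundedUnder_of ⟨0, fun k => dist_nonneg⟩ :
      IsBoundedUnder (· ≥ ·) atTop _).isCoboundedUnder_le
  exact absurd (limsup_le_of_le hcob (eventually_atTop.2 ⟨N, hN⟩)) (not_le.2 hm)

theorem not_isLiYorkeChaotic (n : ℕ) : ¬ IsLiYorkeChaotic (T.map n) := by
  rintro ⟨S, hS, hscr⟩
  refine hS (Set.Subsingleton.countable fun y hy z hz => ?_)
  by_contra hne
  exact T.not_isScrambledPair n y z (hscr y hy z hz hne)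

/-! ### The solenoid -/

/-- The union of the copies of the space of level `m` for `map n`. -/
def cover : ℕ → ℕ → Set X
  | _, 0 => Set.univ
  | n, m + 1 => T.left n '' cover (n + 1) m ∪ T.right n '' cover (n + 1) m

/-- The solenoid of `map n`. -/
def solenoid (n : ℕ) : Set X := ⋂ m, T.cover n m

theorem mapsTo_cover (m n : ℕ) : Set.MapsTo (T.map n) (T.cover n m) (T.cover n m) := by
  induction m generalizing n with
  | zero => exact fun _ _ => trivial
  | succ m ih =>
    rintro _ (⟨x, hx, rfl⟩ | ⟨x, hx, rfl⟩)
    · exact Or.inr ⟨_, ih _ hx, (T.map_left n x).symm⟩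
    · exact Or.inl ⟨_, hx, (T.map_right n x).symm⟩

theorem isClosed_cover [CompactSpace X] (m n : ℕ) : IsClosed (T.cover n m) := by
  induction m generalizing n with
  | zero => exact isClosed_univ
  | succ m ih =>
    exact (((ih _).isCompact.image (T.continuous_left n)).isClosed).union
      (((ih _).isCompact.image (T.continuous_right n)).isClosed)

theorem base_mem_cover (m n : ℕ) : T.base ∈ T.cover n m := by
  induction m generalizing n with
  | zero => trivial
  | succ m ih => exact Or.inl ⟨_, ih _, T.left_base n⟩

/-- Every nonempty invariant part of the cover of level `m` is `3⁻ᵐ`-dense in this cover. -/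
theorem exists_dist_le_of_mapsTo (m n : ℕ) {N : Set X} (hN : N ⊆ T.cover n m)
    (hne : N.Nonempty) (hmaps : Set.MapsTo (T.map n) N N) {x : X} (hx : x ∈ T.cover n m) :
    ∃ y ∈ N, dist x y ≤ (1 / 3) ^ m := by
  induction m generalizing n N x with
  | zero => exact ⟨_, hne.some_mem, by simpa using T.dist_le_one _ _⟩
  | succ m ih =>
    have hinv : Set.MapsTo (T.map (n + 1)) (T.left n ⁻¹' N) (T.left n ⁻¹' N) := by
      intro y hy
      have := hmaps (hmaps hy)
      rwa [T.map_left, T.map_right] at this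
    have hsub : T.left n ⁻¹' N ⊆ T.cover (n + 1) m := by
      intro y hy
      rcases hN hy with ⟨z, hz, hzy⟩ | ⟨z, hz, hzy⟩
      · exact T.left_injective n hzy ▸ hz
      · exact absurd hzy.symm (T.left_ne_right n _ _)
    have hne' : (T.left n ⁻¹' N).Nonempty := by
      obtain ⟨y, hy⟩ := hne
      rcases hN hy with ⟨z, hz, rfl⟩ | ⟨z, hz, rfl⟩
      · exact ⟨z, hy⟩
      · exact ⟨z, by have := hmaps hy; rwa [T.map_right] at this⟩
    rcases hx with ⟨x, hx, rfl⟩ | ⟨x, hx, rfl⟩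
    · obtain ⟨y, hy, hd⟩ := ih (n + 1) hsub hne' hinv hx
      refine ⟨_, hy, ?_⟩
      rw [T.dist_left, pow_succ']
      exact mul_le_mul (T.a_le n) hd dist_nonneg (by norm_num)
    -- In the right copy, `N` contains the right copy of this image, since `right n (map (n + 1) y)
    -- = map n (left n y)`.
    · obtain ⟨_, ⟨y, hy, rfl⟩, hd⟩ := ih (n + 1) (N := T.map (n + 1) '' (T.left n ⁻¹' N))
        (hinv.image_subset.trans hsub) (hne'.image _)
        (by rintro _ ⟨y, hy, rfl⟩; exact ⟨_, hinv hy, rfl⟩) hx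
      refine ⟨_, hmaps hy, ?_⟩
      rw [T.map_left, T.dist_right, pow_succ']
      exact mul_le_mul ((T.b_le_a n).trans (T.a_le n)) hd dist_nonneg (by norm_num)

theorem isMinimalSet_solenoid [CompactSpace X] (n : ℕ) :
    IsMinimalSet (T.map n) (T.solenoid n) := by
  refine ⟨⟨T.base, Set.mem_iInter.2 fun m => T.base_mem_cover m n⟩,
    isClosed_iInter fun m => T.isClosed_cover m n,
    fun x hx => Set.mem_iInter.2 fun m => T.mapsTo_cover m n (Set.mem_iInter.1 hx m), ?_⟩
  intro N hN hne hcl hmaps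
  refine hN.antisymm fun x hx => hcl.closure_subset (Metric.mem_closure_iff.2 fun ε hε => ?_)
  obtain ⟨m, hm⟩ := exists_pow_lt_of_lt_one hε (by norm_num : (1 / 3 : ℝ) < 1)
  obtain ⟨y, hy, hd⟩ := T.exists_dist_le_of_mapsTo m n
    (fun z hz => Set.mem_iInter.1 (hN hz) m) hne hmaps (Set.mem_iInter.1 hx m)
  exact ⟨y, hy, hd.trans_lt hm⟩

/-- Infinite minimal sets renormalize: `D` cannot contain the fixed point, so it meets the left
copy, and `E` is its trace there. -/
theorem exists_isMinimalSet_subset [CompactSpace X] (n : ℕ) {D : Set X} (hinf : D.Infinite)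
    (hmin : IsMinimalSet (T.map n) D) :
    ∃ E : Set X, E.Infinite ∧ IsMinimalSet (T.map (n + 1)) E ∧
      D ⊆ T.left n '' E ∪ T.right n '' E := by
  obtain ⟨⟨x, hx⟩, hcl, hmaps, hmin⟩ := hmin
  have hmem : ∃ z, T.left n z ∈ D := by
    obtain ⟨k, hk⟩ := T.exists_iterate n x
    have hkD := hmaps.iterate k hx
    rcases hk with hk | ⟨z, hz⟩
    · rw [hk] at hkD
      have := hmin {T.fix n} (Set.singleton_subset_iff.2 hkD) (Set.singleton_nonempty _)
        isClosed_singleton (by rintro _ rfl; exact T.map_fix n)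
      exact absurd (this ▸ Set.finite_singleton _) hinf
    · exact ⟨z, hz ▸ hkD⟩
  have hinv : Set.MapsTo (T.map (n + 1)) (T.left n ⁻¹' D) (T.left n ⁻¹' D) := by
    intro y hy
    have := hmaps (hmaps hy)
    rwa [T.map_left, T.map_right] at this
  have hclE : IsClosed (T.left n ⁻¹' D) := hcl.preimage (T.continuous_left n)
  -- A closed invariant part of the trace, together with its image, is closed and invariant in `D`,
  -- hence all of `D`. This gives both the covering of `D` and the minimality of `E`.
  have key : ∀ N ⊆ T.left n ⁻¹' D, N.Nonempty → IsClosed N → Set.MapsTo (T.map (n + 1)) N N →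
      T.left n '' N ∪ T.right n '' (T.map (n + 1) '' N) = D := by
    intro N hN hne hNcl hNmaps
    apply hmin
    · rintro _ (⟨y, hy, rfl⟩ | ⟨_, ⟨y, hy, rfl⟩, rfl⟩)
      · exact hN hy
      · rw [← T.map_left]
        exact hmaps (hN hy)
    · exact (hne.image _).inl
    · exact ((hNcl.isCompact.image (T.continuous_left n)).isClosed).union
        (((hNcl.isCompact.image (T.continuous_map _)).image (T.continuous_right n)).isClosed)
    · rintro _ (⟨y, hy, rfl⟩ | ⟨_, ⟨y, hy, rfl⟩, rfl⟩)
      · exact Or.inr ⟨_, ⟨y, hy, rfl⟩, (T.map_left n y).symm⟩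
      · exact Or.inl ⟨_, hNmaps hy, (T.map_right n _).symm⟩
  have hsub : D ⊆ T.left n '' (T.left n ⁻¹' D) ∪ T.right n '' (T.left n ⁻¹' D) := by
    conv_lhs => rw [← key _ subset_rfl hmem hclE hinv]
    exact Set.union_subset_union_right _ (Set.image_mono hinv.image_subset)
  refine ⟨T.left n ⁻¹' D, fun hfin => hinf (((hfin.image _).union (hfin.image _)).subset hsub),
    ⟨hmem, hclE, hinv, fun N hN hne hNcl hNmaps => hN.antisymm fun y hy => ?_⟩, hsub⟩
  have hyD : T.left n y ∈ D := hy
  rw [← key N hN hne hNcl hNmaps] at hyD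
  rcases hyD with ⟨z, hz, hzy⟩ | ⟨z, -, hzy⟩
  · exact T.left_injective n hzy ▸ hz
  · exact absurd hzy.symm (T.left_ne_right n _ _)

theorem subset_cover_of_isMinimalSet [CompactSpace X] (m n : ℕ) {D : Set X} (hinf : D.Infinite)
    (hmin : IsMinimalSet (T.map n) D) : D ⊆ T.cover n m := by
  induction m generalizing n D with
  | zero => exact Set.subset_univ D
  | succ m ih =>
    obtain ⟨E, hE, hEmin, hDE⟩ := T.exists_isMinimalSet_subset n hinf hmin
    exact hDE.trans (Set.union_subset_union (Set.image_mono (ih _ hE hEmin))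
      (Set.image_mono (ih _ hE hEmin)))

theorem eq_solenoid_of_isMinimalSet [CompactSpace X] (n : ℕ) {D : Set X} (hinf : D.Infinite)
    (hmin : IsMinimalSet (T.map n) D) : D = T.solenoid n :=
  (T.isMinimalSet_solenoid n).2.2.2 D
    (Set.subset_iInter fun m => T.subset_cover_of_isMinimalSet m n hinf hmin)
    hmin.1 hmin.2.1 hmin.2.2.1

/-! ### Distances along orbits in the solenoid -/

/-- Here `s` is the parity of the times spent in the left copy. Only the passage from left to right
applies `map (n + 1)`, whence the two roundings of `k / 2`. -/
theorem exists_code {n m : ℕ} {x : X} (hx : x ∈ T.cover n (m + 1)) :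
    ∃ y ∈ T.cover (n + 1) m, ∃ s < 2, ∀ k,
      (k % 2 = s → (T.map n)^[k] x = T.left n ((T.map (n + 1))^[k / 2] y)) ∧
      (k % 2 ≠ s → (T.map n)^[k] x = T.right n ((T.map (n + 1))^[(k + 1) / 2] y)) := by
  rcases hx with ⟨y, hy, rfl⟩ | ⟨y, hy, rfl⟩
  · refine ⟨y, hy, 0, by norm_num, fun k => ?_⟩
    obtain ⟨i, rfl | rfl⟩ := Nat.even_or_odd' k
    · refine ⟨fun _ => ?_, fun h => by omega⟩
      rw [T.iterate_even_left, show 2 * i / 2 = i by omega]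
    · refine ⟨fun h => by omega, fun _ => ?_⟩
      rw [T.iterate_odd_left, show (2 * i + 1 + 1) / 2 = i + 1 by omega]
  · refine ⟨y, hy, 1, by norm_num, fun k => ?_⟩
    obtain ⟨i, rfl | rfl⟩ := Nat.even_or_odd' k
    · refine ⟨fun h => by omega, fun _ => ?_⟩
      rw [T.iterate_even_right, show (2 * i + 1) / 2 = i by omega]
    · refine ⟨fun _ => ?_, fun h => by omega⟩
      rw [T.iterate_odd_right, show (2 * i + 1) / 2 = i by omega]

/-- Two points of an orbit either lie in different halves, or their distance is a rescaled distance
of two points of an orbit of the next map. -/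
theorem exists_dist_eq {n m : ℕ} {x : X} (hx : x ∈ T.cover n (m + 1)) :
    ∃ y ∈ T.cover (n + 1) m, ∀ i j : ℕ,
      (i % 2 ≠ j % 2 ∧ 1 / 3 ≤ dist ((T.map n)^[i] x) ((T.map n)^[j] x)) ∨
      ∃ c i' j', T.b n ≤ c ∧ c ≤ T.a n ∧ (i : ℤ) - j = 2 * ((i' : ℕ) - (j' : ℕ)) ∧
        dist ((T.map n)^[i] x) ((T.map n)^[j] x) =
          c * dist ((T.map (n + 1))^[i'] y) ((T.map (n + 1))^[j'] y) := by
  obtain ⟨y, hy, s, hs, hc⟩ := T.exists_code hx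
  refine ⟨y, hy, fun i j => ?_⟩
  by_cases hi : i % 2 = s <;> by_cases hj : j % 2 = s
  · refine Or.inr ⟨T.a n, i / 2, j / 2, T.b_le_a n, le_rfl, by omega, ?_⟩
    rw [(hc i).1 hi, (hc j).1 hj, T.dist_left]
  · refine Or.inl ⟨by omega, ?_⟩
    rw [(hc i).1 hi, (hc j).2 hj]
    exact T.dist_left_right _ _ _
  · refine Or.inl ⟨by omega, ?_⟩
    rw [(hc i).2 hi, (hc j).1 hj, dist_comm]
    exact T.dist_left_right _ _ _
  · refine Or.inr ⟨T.b n, (i + 1) / 2, (j + 1) / 2, le_rfl, T.b_le_a n, by omega, ?_⟩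
    rw [(hc i).2 hi, (hc j).2 hj, T.dist_right]

end DoublingTower
end RecDet

namespace RecDet
namespace DoublingTower

variable {X : Type*} [MetricSpace X] (T : DoublingTower X)

theorem dist_le_of_dvd (m n : ℕ) {x : X} (hx : x ∈ T.cover n (m + 1)) {i j : ℕ}
    (h : (2 ^ (m + 1) : ℤ) ∣ i - j) :
    dist ((T.map n)^[i] x) ((T.map n)^[j] x) ≤ T.a (n + m) := by
  induction m generalizing n x i j with
  | zero =>
    obtain ⟨y, -, hxy⟩ := T.exists_dist_eq hx
    obtain ⟨h1, -⟩ | ⟨c, i', j', hbc, hca, -, hd⟩ := hxy i j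
    · rw [zero_add, pow_one] at h
      omega
    · rw [hd]
      exact (mul_le_of_le_one_right ((T.b_pos n).le.trans hbc) (T.dist_le_one _ _)).trans hca
  | succ m ih =>
    obtain ⟨y, hy, hxy⟩ := T.exists_dist_eq hx
    rw [pow_succ'] at h
    obtain ⟨h1, -⟩ | ⟨c, i', j', hbc, hca, hij, hd⟩ := hxy i j
    · have := (dvd_mul_right _ _).trans h
      omega
    · rw [hd, show n + (m + 1) = n + 1 + m by ring]
      rw [hij] at h
      exact (mul_le_of_le_one_left dist_nonneg (hca.trans (T.a_le_one n))).trans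
        (ih (n + 1) hy (Int.dvd_of_mul_dvd_mul_left two_ne_zero h))

/-- The two points part at one of the first `m + 1` levels, with a gap of `1/3` there, shrunk by at
most `m` factors `b`. -/
theorem le_dist_of_not_dvd (m n : ℕ) {x : X} (hx : x ∈ T.cover n (m + 1)) {i j : ℕ}
    (h : ¬ (2 ^ (m + 1) : ℤ) ∣ i - j) :
    1 / 3 * ∏ l ∈ Finset.range m, T.b (n + l) ≤ dist ((T.map n)^[i] x) ((T.map n)^[j] x) := by
  induction m generalizing n x i j with
  | zero =>
    obtain ⟨y, -, hxy⟩ := T.exists_dist_eq hx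
    obtain ⟨-, h1⟩ | ⟨c, i', j', -, -, hij, -⟩ := hxy i j
    · simpa using h1
    · rw [zero_add, pow_one] at h
      omega
  | succ m ih =>
    obtain ⟨y, hy, hxy⟩ := T.exists_dist_eq hx
    obtain ⟨-, h1⟩ | ⟨c, i', j', hbc, -, hij, hd⟩ := hxy i j
    · refine le_trans (mul_le_of_le_one_right (by norm_num) ?_) h1
      exact Finset.prod_le_one (fun l _ => (T.b_pos _).le)
        fun l _ => (T.b_le_a _).trans (T.a_le_one _)
    · rw [pow_succ', hij] at h
      have := ih (n + 1) hy (i := i') (j := j') fun h' => h (mul_dvd_mul_left 2 h')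
      rw [hd, Finset.prod_range_succ', add_zero, ← mul_assoc, mul_comm]
      refine mul_le_mul hbc (le_trans (le_of_eq ?_) this) ?_ ((T.b_pos n).le.trans hbc)
      · simp only [add_assoc, add_comm 1]
      · exact mul_nonneg (by norm_num) (Finset.prod_nonneg fun l _ => (T.b_pos _).le)

/-- Until they part, both points share the same copies; waiting until all of these are left ones
replaces the factors `b` by `a`. -/
theorem exists_le_dist_of_not_dvd (m n : ℕ) {x : X} (hx : x ∈ T.cover n (m + 1)) {i j : ℕ}
    (h : ¬ (2 ^ (m + 1) : ℤ) ∣ i - j) :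
    ∃ k, 1 / 3 * ∏ l ∈ Finset.range m, T.a (n + l) ≤
      dist ((T.map n)^[i + k] x) ((T.map n)^[j + k] x) := by
  induction m generalizing n x i j with
  | zero =>
    refine ⟨0, ?_⟩
    simpa using T.le_dist_of_not_dvd 0 n hx h
  | succ m ih =>
    obtain ⟨y, hy, s, hs, hc⟩ := T.exists_code hx
    by_cases hp : i % 2 = j % 2
    -- The delay `e` brings both points into the left copy; the even delay `2 * k` keeps them there.
    · obtain ⟨e, he⟩ : ∃ e, (i + e) % 2 = s := ⟨i + s, by omega⟩
      have hij : (i : ℤ) - j = 2 * (((i + e) / 2 : ℕ) - ((j + e) / 2 : ℕ)) := by omega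
      rw [pow_succ', hij] at h
      obtain ⟨k, hk⟩ := ih (n + 1) hy (i := (i + e) / 2) (j := (j + e) / 2)
        fun h' => h (mul_dvd_mul_left 2 h')
      refine ⟨e + 2 * k, ?_⟩
      rw [(hc _).1 (by omega), (hc _).1 (by omega), T.dist_left,
        show (i + (e + 2 * k)) / 2 = (i + e) / 2 + k by omega,
        show (j + (e + 2 * k)) / 2 = (j + e) / 2 + k by omega,
        Finset.prod_range_succ', add_zero, ← mul_assoc, mul_comm]
      refine mul_le_mul_of_nonneg_left (le_trans (le_of_eq ?_) hk) (T.a_pos n).le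
      simp only [add_assoc, add_comm 1]
    · refine ⟨0, le_trans (mul_le_of_le_one_right (by norm_num) (Finset.prod_le_one
        (fun l _ => (T.a_pos _).le) fun l _ => T.a_le_one _)) ?_⟩
      rw [add_zero, add_zero]
      by_cases hi : i % 2 = s
      · rw [(hc i).1 hi, (hc j).2 (by omega)]
        exact T.dist_left_right _ _ _
      · rw [(hc i).2 hi, (hc j).1 (by omega), dist_comm]
        exact T.dist_left_right _ _ _

/-- Along some residue class modulo `2 ^ (m + 1)`, the orbit stays in a piece of diameter `b m`. -/
theorem exists_forall_dist_le (m n : ℕ) {x : X} (hx : x ∈ T.cover n (m + 1)) :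
    ∃ i₀, ∀ i j, dist ((T.map n)^[i₀ + 2 ^ (m + 1) * i] x)
      ((T.map n)^[i₀ + 2 ^ (m + 1) * j] x) ≤ T.b (n + m) := by
  induction m generalizing n x with
  | zero =>
    obtain ⟨y, hy, s, hs, hc⟩ := T.exists_code hx
    -- The opposite phase to `s`: the innermost copy must be a right one, of ratio `b`. The outer
    -- ones can be left, as their ratios are only bounded by 1.
    refine ⟨s + 1, fun i j => ?_⟩
    rw [(hc _).2 (by omega), (hc _).2 (by omega), T.dist_right]
    exact mul_le_of_le_one_right (T.b_pos n).le (T.dist_le_one _ _)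
  | succ m ih =>
    obtain ⟨y, hy, s, hs, hc⟩ := T.exists_code hx
    obtain ⟨i₀, hi₀⟩ := ih (n + 1) hy
    have hi : ∀ i, 2 * i₀ + s + 2 ^ (m + 1 + 1) * i = 2 * (i₀ + 2 ^ (m + 1) * i) + s :=
      fun i => by ring
    refine ⟨2 * i₀ + s, fun i j => ?_⟩
    rw [hi, hi, (hc _).1 (by omega), (hc _).1 (by omega), T.dist_left,
      show ∀ k, (2 * k + s) / 2 = k by omega, show ∀ k, (2 * k + s) / 2 = k by omega,
      show n + (m + 1) = n + 1 + m by ring]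
    exact (mul_le_of_le_one_left dist_nonneg (T.a_le_one n)).trans (hi₀ i j)

theorem infinite_solenoid (n : ℕ) : (T.solenoid n).Infinite := by
  have hbase : ∀ m, T.base ∈ T.cover n m := fun m => T.base_mem_cover m n
  refine Set.infinite_of_injective_forall_mem (f := fun k => (T.map n)^[k] T.base) ?_ fun k =>
    Set.mem_iInter.2 fun m => (T.mapsTo_cover m n).iterate k (hbase m)
  intro i j hij
  by_contra hne
  obtain ⟨m, hm⟩ : ∃ m : ℕ, ¬ (2 ^ (m + 1) : ℤ) ∣ i - j := by
    -- A nonzero difference of size at most `i + j` is not divisible by `2 ^ (i + j + 1)`.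
    refine ⟨i + j, fun h => ?_⟩
    have h1 := Int.le_of_dvd (abs_pos.2 (by omega)) ((dvd_abs _ _).2 h)
    have h2 : ((i + j + 1 : ℕ) : ℤ) < 2 ^ (i + j + 1) := by exact_mod_cast Nat.lt_two_pow_self
    have h3 : |(i : ℤ) - j| ≤ i + j := abs_le.2 ⟨by omega, by omega⟩
    push_cast at h2
    omega
  have h := T.le_dist_of_not_dvd m n (hbase _) hm
  rw [show (T.map n)^[i] T.base = (T.map n)^[j] T.base from hij, dist_self] at h
  exact absurd h (not_le.2 (mul_pos (by norm_num) (Finset.prod_pos fun l _ => T.b_pos _)))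

end DoublingTower

/-! ### Recurrence determinism -/

section Rdet

variable {X : Type*} [MetricSpace X] [CompactSpace X] (f : X → X)

theorem bowenDist_one_le_iff (x y : X) (ε : ℝ) : bowenDist f 1 x y ≤ ε ↔ dist x y ≤ ε := by
  rw [bowenDist_le_iff f 1 le_rfl]
  constructor
  · intro h
    exact h 0 (by simp)
  · intro h i hi
    obtain rfl : i = 0 := by
      have : i < 1 := by exact_mod_cast hi
      omega
    exact h

theorem bowenDist_top_le_iff (x y : X) (ε : ℝ) :
    bowenDist f ⊤ x y ≤ ε ↔ ∀ i : ℕ, dist (f^[i] x) (f^[i] y) ≤ ε := by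
  rw [bowenDist_le_iff f ⊤ le_top]
  exact forall_congr' fun i => ⟨fun h => h (ENat.natCast_lt_top i), fun h _ => h⟩

omit [CompactSpace X] in
theorem corrSum_nonneg (m : ℕ∞) (x : X) (n : ℕ) (ε : ℝ) : 0 ≤ corrSum f m x n ε := by
  unfold corrSum
  positivity

omit [CompactSpace X] in
theorem corrSum_le_corrSum {m m' : ℕ∞} {x : X} {n : ℕ} {ε : ℝ}
    (h : ∀ i j : ℕ, bowenDist f m (f^[i] x) (f^[j] x) ≤ ε →
      bowenDist f m' (f^[i] x) (f^[j] x) ≤ ε) : corrSum f m x n ε ≤ corrSum f m' x n ε := by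
  classical
  unfold corrSum
  refine div_le_div_of_nonneg_right (Nat.cast_le.2 (Finset.card_le_card fun p hp => ?_))
    (by positivity)
  rw [Finset.mem_filter] at hp ⊢
  exact ⟨hp.1, h _ _ hp.2⟩

theorem corrSum_top_le (x : X) (n : ℕ) (ε : ℝ) : corrSum f ⊤ x n ε ≤ corrSum f 1 x n ε := by
  refine corrSum_le_corrSum f fun i j h => ?_
  rw [bowenDist_top_le_iff] at h
  exact (bowenDist_one_le_iff f _ _ _).2 (h 0)

theorem corrSum_one_pos (x : X) {n : ℕ} (hn : 0 < n) {ε : ℝ} (hε : 0 ≤ ε) :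
    0 < corrSum f 1 x n ε := by
  classical
  unfold corrSum
  refine div_pos (Nat.cast_pos.2 (Finset.card_pos.2 ⟨(0, 0), ?_⟩)) (by positivity)
  simp only [Finset.mem_filter, Finset.mem_product, Finset.mem_range, hn, true_and,
    bowenDist_one_le_iff, dist_self, hε]

omit [CompactSpace X] in
theorem rdet_top_nonneg (x : X) (n : ℕ) (ε : ℝ) : 0 ≤ rdet f ⊤ x n ε :=
  div_nonneg (corrSum_nonneg f _ x n ε) (corrSum_nonneg f _ x n ε)

theorem rdet_top_le_one (x : X) (n : ℕ) (ε : ℝ) : rdet f ⊤ x n ε ≤ 1 :=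
  div_le_one_of_le₀ (corrSum_top_le f x n ε) (corrSum_nonneg f _ x n ε)

theorem isBoundedUnder_le_rdet (x : X) (ε : ℝ) (l : Filter ℕ) :
    IsBoundedUnder (· ≤ ·) l fun n => rdet f ⊤ x n ε :=
  isBoundedUnder_of ⟨1, fun n => rdet_top_le_one f x n ε⟩

omit [CompactSpace X] in
theorem isBoundedUnder_ge_rdet (x : X) (ε : ℝ) (l : Filter ℕ) :
    IsBoundedUnder (· ≥ ·) l fun n => rdet f ⊤ x n ε :=
  isBoundedUnder_of ⟨0, fun n => rdet_top_nonneg f x n ε⟩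

omit [CompactSpace X] in
theorem upperRdet_le_of_eventually {x : X} {ε c : ℝ}
    (h : ∀ᶠ n in atTop, rdet f ⊤ x n ε ≤ c) : upperRdet f ⊤ x ε ≤ c :=
  limsup_le_of_le (isBoundedUnder_ge_rdet f x ε atTop).isCoboundedUnder_le h

theorem lowerRdet_le_upperRdet (x : X) (ε : ℝ) : lowerRdet f ⊤ x ε ≤ upperRdet f ⊤ x ε :=
  liminf_le_limsup (isBoundedUnder_le_rdet f x ε atTop) (isBoundedUnder_ge_rdet f x ε atTop)

theorem upperRdet_le_one (x : X) (ε : ℝ) : upperRdet f ⊤ x ε ≤ 1 :=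
  upperRdet_le_of_eventually f (Eventually.of_forall fun n => rdet_top_le_one f x n ε)

theorem lowerRdet_nonneg (x : X) (ε : ℝ) : 0 ≤ lowerRdet f ⊤ x ε :=
  le_liminf_of_le (isBoundedUnder_le_rdet f x ε atTop).isCoboundedUnder_ge
    (Eventually.of_forall fun n => rdet_top_nonneg f x n ε)

/-- If along the orbit of `x` closeness implies closeness for all times, then the recurrence
determinism at `x` is `1`. -/
theorem rdetExistsEq_one {x : X} {ε : ℝ} (hε : 0 ≤ ε)
    (h : ∀ i j, dist (f^[i] x) (f^[j] x) ≤ ε → ∀ k, dist (f^[i + k] x) (f^[j + k] x) ≤ ε) :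
    RdetExistsEq f ⊤ x ε 1 := by
  have hev : (fun n => rdet f ⊤ x n ε) =ᶠ[atTop] fun _ => 1 := by
    filter_upwards [eventually_gt_atTop 0] with n hn
    refine div_eq_one_iff_eq (corrSum_one_pos f x hn hε).ne' |>.2 (le_antisymm
      (corrSum_top_le f x n ε) ?_)
    refine corrSum_le_corrSum f fun i j hp => ?_
    rw [bowenDist_one_le_iff] at hp
    refine (bowenDist_top_le_iff f _ _ _).2 fun k => ?_
    rw [← Function.iterate_add_apply, ← Function.iterate_add_apply, add_comm k, add_comm k]
    exact h _ _ hp k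
  have ht : Tendsto (fun n => rdet f ⊤ x n ε) atTop (𝓝 1) :=
    tendsto_const_nhds.congr' hev.symm
  exact ⟨ht.liminf_eq, ht.limsup_eq⟩

/-- For each `i` the admissible `j` lie in one residue class modulo `q`, so there are at most `n / q
+ 1` of them, which is at most `2 * n / q` once `n ≥ q`. -/
theorem corrSum_top_le_of_dvd {x : X} {ε : ℝ} {q : ℕ} (hq : 0 < q)
    (h : ∀ i j : ℕ, (∀ k, dist (f^[i + k] x) (f^[j + k] x) ≤ ε) → (q : ℤ) ∣ i - j) :
    ∀ᶠ n in atTop, corrSum f ⊤ x n ε ≤ 2 / q := by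
  classical
  filter_upwards [eventually_ge_atTop q] with n hn
  have hn0 : 0 < n := hq.trans_le hn
  unfold corrSum
  rw [div_le_div_iff₀ (by positivity) (by positivity)]
  have hcard : ((Finset.range n ×ˢ Finset.range n).filter (fun p : ℕ × ℕ =>
      bowenDist f ⊤ (f^[p.1] x) (f^[p.2] x) ≤ ε)).card ≤
      ∑ _i ∈ Finset.range n, (n / q + 1) := by
    refine (Finset.card_le_card_of_injOn (t := Finset.range n ×ˢ Finset.range (n / q + 1))
      (fun p => (p.1, p.2 / q)) ?_ ?_).trans (by simp)
    · intro p hp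
      simp only [Finset.coe_filter, Finset.mem_product, Finset.mem_range, Set.mem_ofPred_eq,
        Finset.coe_product, Finset.coe_range, Set.mem_prod, Set.mem_Iio] at hp ⊢
      exact ⟨hp.1.1, Nat.lt_succ_of_le (Nat.div_le_div_right hp.1.2.le)⟩
    · have hdvd : ∀ p ∈ (Finset.range n ×ˢ Finset.range n).filter (fun p : ℕ × ℕ =>
          bowenDist f ⊤ (f^[p.1] x) (f^[p.2] x) ≤ ε), (q : ℤ) ∣ (p.1 : ℤ) - p.2 := by
        intro p hp
        have h2 := (bowenDist_top_le_iff f _ _ _).1 (Finset.mem_filter.1 hp).2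
        refine h _ _ fun k => ?_
        have := h2 k
        rwa [← Function.iterate_add_apply, ← Function.iterate_add_apply, add_comm k,
          add_comm k] at this
      rintro ⟨i, j⟩ hp ⟨i', j'⟩ hp' heq
      have h1 := hdvd _ hp
      have h2 := hdvd _ hp'
      simp only [Prod.mk.injEq] at heq h1 h2 ⊢
      obtain ⟨rfl, heq⟩ := heq
      refine ⟨rfl, ?_⟩
      have h3 : j ≡ j' [MOD q] := by
        rw [Nat.modEq_iff_dvd]
        have := dvd_sub h1 h2
        rwa [sub_sub_sub_cancel_left] at this
      rw [← Nat.div_add_mod j q, ← Nat.div_add_mod j' q, heq, h3]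
  rw [Finset.sum_const, Finset.card_range, smul_eq_mul] at hcard
  have h1 : n / q * q ≤ n := Nat.div_mul_le_self n q
  have h2 : n * (n / q + 1) * q ≤ 2 * n ^ 2 := by nlinarith
  exact_mod_cast (Nat.mul_le_mul_right q hcard).trans h2

theorem le_corrSum_one {x : X} {ε : ℝ} {q i₀ : ℕ} (hq : 0 < q)
    (h : ∀ i j : ℕ, dist (f^[i₀ + q * i] x) (f^[i₀ + q * j] x) ≤ ε) :
    ∀ᶠ n in atTop, 1 / (2 * q : ℝ) ^ 2 ≤ corrSum f 1 x n ε := by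
  classical
  -- This bound makes the number `r` of terms of the progression used below `n` at least `n / (2 *
  -- q)`; all `r * r` pairs of them count.
  filter_upwards [eventually_gt_atTop (2 * i₀ + 2 * q)] with n hn
  have hn0 : 0 < n := by omega
  obtain ⟨r, hr⟩ : ∃ r, r = (n - i₀) / q := ⟨_, rfl⟩
  have hr1 : q * r ≤ n - i₀ := hr ▸ Nat.mul_div_le _ _
  have hr2 : n - i₀ < q * r + q := by
    have := Nat.lt_mul_div_succ (n - i₀) hq
    rwa [← hr, mul_add, mul_one] at this
  have hr3 : n ≤ 2 * q * r := by rw [mul_assoc]; omega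
  unfold corrSum
  rw [div_le_div_iff₀ (by positivity) (by positivity), one_mul]
  have hcard : r * r ≤ ((Finset.range n ×ˢ Finset.range n).filter (fun p : ℕ × ℕ =>
      bowenDist f 1 (f^[p.1] x) (f^[p.2] x) ≤ ε)).card := by
    have hlt : ∀ i < r, i₀ + q * i < n := fun i hi => by
      have : q * (i + 1) ≤ q * r := Nat.mul_le_mul_left q hi
      rw [mul_add] at this
      omega
    have hinj : ∀ i j, i₀ + q * i = i₀ + q * j → i = j := fun i j hij =>
      Nat.eq_of_mul_eq_mul_left hq (Nat.add_left_cancel hij)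
    refine le_of_eq_of_le (by rw [Finset.card_product, Finset.card_range])
      (Finset.card_le_card_of_injOn (s := Finset.range r ×ˢ Finset.range r) (fun p => (i₀ + q * p.1, i₀ + q * p.2)) ?_ ?_)
    · intro p hp
      simp only [Finset.coe_product, Finset.coe_range, Set.mem_prod, Set.mem_Iio] at hp
      simp only [Finset.coe_filter, Finset.mem_product, Finset.mem_range, Set.mem_ofPred_eq,
        bowenDist_one_le_iff]
      exact ⟨⟨hlt _ hp.1, hlt _ hp.2⟩, h _ _⟩
    · rintro ⟨i, j⟩ - ⟨i', j'⟩ - heq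
      simp only [Prod.mk.injEq] at heq ⊢
      exact ⟨hinj _ _ heq.1, hinj _ _ heq.2⟩
  have h2 : n ^ 2 ≤ r * r * (2 * q) ^ 2 := by
    calc n ^ 2 ≤ (2 * q * r) ^ 2 := Nat.pow_le_pow_left hr3 2
      _ = r * r * (2 * q) ^ 2 := by ring
  exact_mod_cast h2.trans (Nat.mul_le_mul_right _ hcard)

end Rdet

/-! ### Determinism on the solenoid at the scales `a m` and `b m`. -/

namespace DoublingTower

variable {X : Type*} [MetricSpace X] [CompactSpace X] (T : DoublingTower X)

theorem rdetExistsEq_one_of_lt {m : ℕ} {x : X} (hx : x ∈ T.solenoid 0)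
    (h : T.a m < 1 / 3 * ∏ l ∈ Finset.range m, T.b l) :
    RdetExistsEq (T.map 0) ⊤ x (T.a m) 1 := by
  have hxm : x ∈ T.cover 0 (m + 1) := Set.mem_iInter.1 hx _
  refine rdetExistsEq_one _ (T.a_pos m).le fun i j hij k => ?_
  have hdvd : (2 ^ (m + 1) : ℤ) ∣ i - j := by
    by_contra hnd
    have := T.le_dist_of_not_dvd m 0 hxm hnd
    simp only [zero_add] at this
    exact absurd (this.trans hij) (not_le.2 h)
  have := T.dist_le_of_dvd m 0 hxm (i := i + k) (j := j + k) (by push_cast; simpa using hdvd)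
  rwa [zero_add] at this

theorem upperRdet_le_of_lt {m M : ℕ} {x : X} (hx : x ∈ T.solenoid 0)
    (h : T.b m < 1 / 3 * ∏ l ∈ Finset.range M, T.a l) :
    upperRdet (T.map 0) ⊤ x (T.b m) ≤ 2 / 2 ^ (M + 1) * (2 * 2 ^ (m + 1)) ^ 2 := by
  have hx' : ∀ k, x ∈ T.cover 0 k := Set.mem_iInter.1 hx
  obtain ⟨i₀, hi₀⟩ := T.exists_forall_dist_le m 0 (hx' _)
  simp only [zero_add] at hi₀
  apply upperRdet_le_of_eventually
  have h1 := corrSum_top_le_of_dvd (T.map 0) (x := x) (ε := T.b m) (q := 2 ^ (M + 1))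
    (by positivity) fun i j hij => by
      by_contra hnd
      push_cast at hnd
      obtain ⟨k, hk⟩ := T.exists_le_dist_of_not_dvd M 0 (hx' _) hnd
      simp only [zero_add] at hk
      exact absurd (hk.trans (hij k)) (not_le.2 h)
  have h2 := le_corrSum_one (T.map 0) (x := x) (ε := T.b m) (q := 2 ^ (m + 1)) (i₀ := i₀)
    (by positivity) hi₀
  filter_upwards [h1, h2] with n h1 h2
  push_cast at h1 h2
  have hpos : (0 : ℝ) < 1 / (2 * 2 ^ (m + 1)) ^ 2 := by positivity
  calc rdet (T.map 0) ⊤ x n (T.b m)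
      ≤ 2 / 2 ^ (M + 1) / (1 / (2 * 2 ^ (m + 1)) ^ 2) :=
        div_le_div₀ (by positivity) h1 hpos h2
    _ = _ := by rw [div_div_eq_mul_div, div_one]

end DoublingTower
end RecDet

/-! ### Realization of a tower on the unit interval. -/

namespace RecDet

noncomputable section

/-- The projection of the real line onto the unit interval. -/
def clamp (t : ℝ) : ℝ := max 0 (min 1 t)

theorem continuous_clamp : Continuous clamp := by
  unfold clamp
  fun_prop

theorem clamp_nonneg (t : ℝ) : 0 ≤ clamp t := le_max_left _ _

theorem clamp_le_one (t : ℝ) : clamp t ≤ 1 := max_le zero_le_one (min_le_left _ _)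

theorem clamp_of_le {t : ℝ} (h : t ≤ 0) : clamp t = 0 :=
  max_eq_left ((min_le_right _ _).trans h)

theorem clamp_of_ge {t : ℝ} (h : 1 ≤ t) : clamp t = 1 := by
  rw [clamp, min_eq_left h, max_eq_right zero_le_one]

theorem clamp_of_mem {t : ℝ} (h0 : 0 ≤ t) (h1 : t ≤ 1) : clamp t = t := by
  rw [clamp, min_eq_right h1, max_eq_right h0]

/-- The piecewise linear map which is `1` on `(-∞, a]`, `a` at `1 - b` and `0` on `[1, ∞)`. -/
def hat (a b x : ℝ) : ℝ :=
  1 - (1 - a) * clamp ((x - a) / (1 - a - b)) - a * clamp ((x - 1 + b) / b)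

/-- The terms of the series which defines `towerMap`. -/
def towerTerm (a b : ℕ → ℝ) : ℕ → ℕ → ℝ → ℝ
  | 0, n, x => hat (a n) (b n) x
  | k + 1, n, x => -b n * towerTerm a b k (n + 1) (clamp (x / a n))

/-- The solution of the functional equations
`f n x = hat (a n) (b n) x - b n * f (n + 1) (clamp (x / a n))`. -/
def towerMap (a b : ℕ → ℝ) (n : ℕ) (x : ℝ) : ℝ := ∑' k, towerTerm a b k n x

section

variable {a b : ℝ}

theorem hat_nonneg (h0 : 0 ≤ a) (h1 : a ≤ 1) (x : ℝ) : 0 ≤ hat a b x := by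
  unfold hat
  nlinarith [clamp_le_one ((x - a) / (1 - a - b)), clamp_le_one ((x - 1 + b) / b)]

theorem hat_le_one (h0 : 0 ≤ a) (h1 : a ≤ 1) (x : ℝ) : hat a b x ≤ 1 := by
  unfold hat
  nlinarith [clamp_nonneg ((x - a) / (1 - a - b)), clamp_nonneg ((x - 1 + b) / b)]

theorem continuous_hat : Continuous (hat a b) := by
  unfold hat
  have := continuous_clamp
  fun_prop

theorem hat_of_le (hb : 0 < b) (hab : a + b < 1) {x : ℝ} (hx : x ≤ a) : hat a b x = 1 := by
  rw [hat, clamp_of_le (div_nonpos_of_nonpos_of_nonneg (by linarith) (by linarith)),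
    clamp_of_le (div_nonpos_of_nonpos_of_nonneg (by linarith) hb.le)]
  ring

theorem hat_of_mem (hb : 0 < b) (hab : a + b < 1) {x : ℝ} (hx : a ≤ x) (hx' : x ≤ 1 - b) :
    hat a b x = 1 - (1 - a) * ((x - a) / (1 - a - b)) := by
  rw [hat, clamp_of_mem (div_nonneg (by linarith) (by linarith))
      ((div_le_one (by linarith)).2 (by linarith)),
    clamp_of_le (div_nonpos_of_nonpos_of_nonneg (by linarith) hb.le)]
  ring

theorem hat_of_ge (hb : 0 < b) (hab : a + b < 1) {x : ℝ} (hx : 1 - b ≤ x) (hx' : x ≤ 1) :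
    hat a b x = a * ((1 - x) / b) := by
  rw [hat, clamp_of_ge ((one_le_div (by linarith)).2 (by linarith)),
    clamp_of_mem (div_nonneg (by linarith) hb.le) ((div_le_one hb).2 (by linarith))]
  field_simp
  ring

theorem hat_of_one_le (hb : 0 < b) (hab : a + b < 1) {x : ℝ} (hx : 1 ≤ x) : hat a b x = 0 := by
  rw [hat, clamp_of_ge ((one_le_div (by linarith)).2 (by linarith)),
    clamp_of_ge ((one_le_div hb).2 (by linarith))]
  ring

end

section

variable {a b : ℕ → ℝ} (hb : ∀ n, 0 < b n) (hba : ∀ n, b n ≤ a n) (ha : ∀ n, a n ≤ 1 / 3)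

include hb hba ha

theorem norm_towerTerm_le (k n : ℕ) (x : ℝ) : ‖towerTerm a b k n x‖ ≤ (1 / 3) ^ k := by
  induction k generalizing n x with
  | zero =>
    have h0 := (hb n).le.trans (hba n)
    have h1 := (ha n).trans (by norm_num : (1 / 3 : ℝ) ≤ 1)
    rw [towerTerm, Real.norm_of_nonneg (hat_nonneg h0 h1 x), pow_zero]
    exact hat_le_one h0 h1 x
  | succ k ih =>
    rw [towerTerm, norm_mul, norm_neg, Real.norm_of_nonneg (hb n).le, pow_succ']
    exact mul_le_mul ((hba n).trans (ha n)) (ih _ _) (norm_nonneg _) (by norm_num)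

theorem summable_towerTerm (n : ℕ) (x : ℝ) : Summable fun k => towerTerm a b k n x :=
  .of_norm_bounded (summable_geometric_of_lt_one (by norm_num) (by norm_num))
    fun k => norm_towerTerm_le hb hba ha k n x

theorem towerMap_eq (n : ℕ) (x : ℝ) :
    towerMap a b n x = hat (a n) (b n) x - b n * towerMap a b (n + 1) (clamp (x / a n)) := by
  rw [towerMap, (summable_towerTerm hb hba ha n x).tsum_eq_zero_add, towerMap, ← tsum_mul_left,
    sub_eq_add_neg, ← tsum_neg]
  simp only [towerTerm, neg_mul]

theorem continuous_towerMap (n : ℕ) : Continuous (towerMap a b n) := by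
  have hk : ∀ k n, Continuous (towerTerm a b k n) := by
    intro k
    induction k with
    | zero => exact fun n => continuous_hat
    | succ k ih =>
      exact fun n => continuous_const.mul ((ih _).comp
        (continuous_clamp.comp (continuous_id.div_const _)))
  exact continuous_tsum (fun k => hk k n)
    (summable_geometric_of_lt_one (by norm_num) (by norm_num))
    fun k x => norm_towerTerm_le hb hba ha k n x

/-- Finite sums provide the induction that the functional equation for the full series lacks.
Vanishing at 1 is carried along because it kills the correction for `x ≥ a n`; for `x ≤ a n` the
correction is subtracted from 1. -/
theorem sum_towerTerm_mem (K n : ℕ) (x : ℝ) :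
    (0 ≤ ∑ k ∈ Finset.range K, towerTerm a b k n x ∧
      ∑ k ∈ Finset.range K, towerTerm a b k n x ≤ 1) ∧
      (1 ≤ x → ∑ k ∈ Finset.range K, towerTerm a b k n x = 0) := by
  induction K generalizing n x with
  | zero => simp
  | succ K ih =>
    have hbn := hb n
    have hban := hba n
    have han := ha n
    have hpos : 0 < a n := hbn.trans_le hban
    obtain ⟨⟨h0, h1⟩, h2⟩ := ih (n + 1) (clamp (x / a n))
    simp only [Finset.sum_range_succ', towerTerm, ← Finset.mul_sum]
    generalize ∑ k ∈ Finset.range K, towerTerm a b k (n + 1) (clamp (x / a n)) = s at h0 h1 h2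
    rcases le_total x (a n) with hx | hx
    · rw [hat_of_le hbn (by linarith) hx]
      exact ⟨⟨by nlinarith, by nlinarith⟩, fun h => by linarith⟩
    · rw [h2 (clamp_of_ge ((one_le_div hpos).2 hx)).ge, mul_zero, zero_add]
      exact ⟨⟨hat_nonneg hpos.le (by linarith) x, hat_le_one hpos.le (by linarith) x⟩,
        hat_of_one_le hbn (by linarith)⟩

theorem towerMap_mem (n : ℕ) (x : ℝ) : towerMap a b n x ∈ unitInterval := by
  have h := (summable_towerTerm hb hba ha n x).hasSum.tendsto_sum_nat
  exact ⟨ge_of_tendsto' h fun K => (sum_towerTerm_mem hb hba ha K n x).1.1,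
    le_of_tendsto' h fun K => (sum_towerTerm_mem hb hba ha K n x).1.2⟩

theorem towerMap_one (n : ℕ) : towerMap a b n 1 = 0 := by
  have h := (summable_towerTerm hb hba ha n 1).hasSum.tendsto_sum_nat
  refine tendsto_nhds_unique h (tendsto_const_nhds.congr fun K => ?_)
  exact ((sum_towerTerm_mem hb hba ha K n 1).2 le_rfl).symm

theorem towerMap_mul (n : ℕ) {x : ℝ} (hx : x ∈ unitInterval) :
    towerMap a b n (a n * x) = 1 - b n * towerMap a b (n + 1) x := by
  have hpos : 0 < a n := (hb n).trans_le (hba n)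
  have := ha n
  have := hba n
  rw [towerMap_eq hb hba ha, hat_of_le (hb n) (by linarith) (mul_le_of_le_one_right hpos.le hx.2),
    mul_div_cancel_left₀ _ hpos.ne', clamp_of_mem hx.1 hx.2]

theorem towerMap_of_ge (n : ℕ) {x : ℝ} (hx : a n ≤ x) : towerMap a b n x = hat (a n) (b n) x := by
  have hpos : 0 < a n := (hb n).trans_le (hba n)
  rw [towerMap_eq hb hba ha, clamp_of_ge ((one_le_div hpos).2 hx), towerMap_one hb hba ha,
    mul_zero, sub_zero]

theorem towerMap_one_sub (n : ℕ) {x : ℝ} (hx : x ∈ unitInterval) :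
    towerMap a b n (1 - b n * x) = a n * x := by
  have := ha n
  have := hba n
  have hbn := hb n
  have h1 : b n * x ≤ b n := mul_le_of_le_one_right hbn.le hx.2
  have h0 : 0 ≤ b n * x := mul_nonneg hbn.le hx.1
  rw [towerMap_of_ge hb hba ha n (by linarith), hat_of_ge hbn (by linarith) (by linarith)
    (by linarith), sub_sub_cancel, mul_div_cancel_left₀ _ hbn.ne']

end

/-- The expansion factor of the middle branch. -/
def slope (a b : ℝ) : ℝ := (1 - a) / (1 - a - b)

/-- The fixed point of the middle branch. -/
def midFix (a b : ℝ) : ℝ := (1 + slope a b * a) / (1 + slope a b)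

section

variable {a b : ℝ} (hb : 0 < b) (hba : b ≤ a) (ha : a ≤ 1 / 3)

include hb hba ha

theorem one_lt_slope : 1 < slope a b := by
  rw [slope, one_lt_div (by linarith)]
  linarith

theorem midFix_eq : 1 - slope a b * (midFix a b - a) = midFix a b := by
  have := one_lt_slope hb hba ha
  rw [midFix]
  field_simp
  ring

theorem lt_midFix : a < midFix a b := by
  have := one_lt_slope hb hba ha
  rw [midFix, lt_div_iff₀ (by linarith)]
  linarith

/-- The decreasing middle branch has the value `a < 1 - b` at `1 - b`, so it crosses the diagonal
earlier. -/
theorem midFix_lt : midFix a b < 1 - b := by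
  have h1 := midFix_eq hb hba ha
  have h2 : slope a b * (1 - a - b) = 1 - a := by
    rw [slope, div_mul_cancel₀]
    linarith
  have h3 := one_lt_slope hb hba ha
  by_contra! h
  nlinarith

theorem midFix_mem : midFix a b ∈ unitInterval := by
  have := lt_midFix hb hba ha
  have := midFix_lt hb hba ha
  exact ⟨by linarith, by linarith⟩

theorem hat_eq_midFix_sub {x : ℝ} (hx : a ≤ x) (hx' : x ≤ 1 - b) :
    hat a b x = midFix a b - slope a b * (x - midFix a b) := by
  rw [hat_of_mem hb (by linarith) hx hx']
  have := midFix_eq hb hba ha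
  have h : (1 - a) * ((x - a) / (1 - a - b)) = slope a b * (x - a) := by rw [slope]; ring
  rw [h]
  linarith

end

/-- The doubling tower on the unit interval with prescribed ratios. -/
def intervalTower (a b : ℕ → ℝ) (hb : ∀ n, 0 < b n) (hba : ∀ n, b n ≤ a n)
    (ha : ∀ n, a n ≤ 1 / 3) : DoublingTower unitInterval where
  map n x := ⟨towerMap a b n x, towerMap_mem hb hba ha n x⟩
  left n x := ⟨a n * x, unitInterval.mul_mem
    ⟨(hb n).le.trans (hba n), (ha n).trans (by norm_num)⟩ x.2⟩
  right n x := ⟨1 - b n * x, Set.Icc.mem_iff_one_sub_mem.1 (unitInterval.mul_mem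
    ⟨(hb n).le, (hba n).trans ((ha n).trans (by norm_num))⟩ x.2)⟩
  a := a
  b := b
  fix n := ⟨midFix (a n) (b n), midFix_mem (hb n) (hba n) (ha n)⟩
  base := 0
  b_pos := hb
  b_le_a := hba
  a_le := ha
  dist_le_one x y := by
    rw [Subtype.dist_eq, Real.dist_eq, abs_le]
    exact ⟨by linarith [x.2.1, y.2.2], by linarith [x.2.2, y.2.1]⟩
  continuous_map n := ((continuous_towerMap hb hba ha n).comp continuous_subtype_val).subtype_mk _
  dist_left n x y := by
    rw [Subtype.dist_eq, Subtype.dist_eq, Real.dist_eq, Real.dist_eq, ← mul_sub, abs_mul,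
      abs_of_pos ((hb n).trans_le (hba n))]
  dist_right n x y := by
    rw [Subtype.dist_eq, Subtype.dist_eq, Real.dist_eq, Real.dist_eq, sub_sub_sub_cancel_left,
      ← mul_sub, abs_mul, abs_of_pos (hb n), abs_sub_comm]
  dist_left_right n x y := by
    rw [Subtype.dist_eq, Real.dist_eq, abs_sub_comm]
    refine le_trans ?_ (le_abs_self _)
    have h1 : a n * x ≤ a n := mul_le_of_le_one_right ((hb n).le.trans (hba n)) x.2.2
    have h2 : b n * y ≤ b n := mul_le_of_le_one_right (hb n).le y.2.2
    have := ha n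
    have := hba n
    simp only
    linarith
  map_left n x := Subtype.ext (towerMap_mul hb hba ha n x.2)
  map_right n x := Subtype.ext (towerMap_one_sub hb hba ha n x.2)
  map_fix n := by
    have h1 := lt_midFix (hb n) (hba n) (ha n)
    have h2 := midFix_lt (hb n) (hba n) (ha n)
    refine Subtype.ext ((towerMap_of_ge hb hba ha n h1.le).trans ?_)
    rw [hat_eq_midFix_sub (hb n) (hba n) (ha n) h1.le h2.le]
    ring
  fix_separated n := by
    have h1 := lt_midFix (hb n) (hba n) (ha n)
    have h2 := midFix_lt (hb n) (hba n) (ha n)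
    refine ⟨min (midFix (a n) (b n) - a n) (1 - b n - midFix (a n) (b n)),
      lt_min (by linarith) (by linarith), fun x => ⟨?_, ?_⟩⟩ <;>
      rw [Subtype.dist_eq, Real.dist_eq]
    · refine (min_le_left _ _).trans (le_trans ?_ (le_abs_self _))
      have : a n * x ≤ a n := mul_le_of_le_one_right ((hb n).le.trans (hba n)) x.2.2
      simp only
      linarith
    · rw [abs_sub_comm]
      refine (min_le_right _ _).trans (le_trans ?_ (le_abs_self _))
      have : b n * x ≤ b n := mul_le_of_le_one_right (hb n).le x.2.2
      simp only
      linarith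
  left_base n := Subtype.ext (mul_zero _)
  exists_iterate n x := by
    set F : unitInterval → unitInterval := fun x => ⟨towerMap a b n x, towerMap_mem hb hba ha n x⟩
      with hF
    have hbn := hb n
    have hban := hba n
    have han := ha n
    set p := midFix (a n) (b n) with hp
    set s := slope (a n) (b n) with hs
    have hs1 : 1 < s := one_lt_slope hbn hban han
    have hp1 : a n < p := lt_midFix hbn hban han
    by_contra! hcon
    -- An orbit avoiding the left copy avoids the right one too, which is mapped into the left one;
    -- so it stays on the middle branch.
    have hmid : ∀ k, a n < F^[k] x ∧ (F^[k] x : ℝ) < 1 - b n := by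
      intro k
      constructor
      · by_contra! h
        refine (hcon k).2 ⟨⟨(F^[k] x : ℝ) / a n, div_nonneg (F^[k] x).2.1 (by linarith),
          (div_le_one (by linarith)).2 h⟩, Subtype.ext ?_⟩
        exact mul_div_cancel₀ _ (by linarith)
      · by_contra! h
        refine (hcon (k + 1)).2 ⟨⟨(1 - (F^[k] x : ℝ)) / b n,
          div_nonneg (by linarith [(F^[k] x).2.2]) hbn.le,
          (div_le_one hbn).2 (by linarith)⟩, Subtype.ext ?_⟩
        rw [Function.iterate_succ_apply']
        simp only [hF]
        rw [towerMap_of_ge hb hba ha n (by linarith), hat_of_ge hbn (by linarith) h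
          (F^[k] x).2.2]
    -- The middle branch expands distances to its fixed point by `s > 1`, so no other orbit stays
    -- there.
    have hpow : ∀ k, |(F^[k] x : ℝ) - p| = s ^ k * |(x : ℝ) - p| := by
      intro k
      induction k with
      | zero => simp
      | succ k ih =>
        have : (F^[k + 1] x : ℝ) = p - s * ((F^[k] x : ℝ) - p) := by
          rw [Function.iterate_succ_apply', hF]
          exact (towerMap_of_ge hb hba ha n (hmid k).1.le).trans
            (hat_eq_midFix_sub hbn hban han (hmid k).1.le (hmid k).2.le)
        rw [this, sub_sub_cancel_left, abs_neg, abs_mul, ih, abs_of_pos (by linarith), pow_succ']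
        ring
    have hxp : 0 < |(x : ℝ) - p| := by
      rw [abs_pos, sub_ne_zero]
      exact fun h => (hcon 0).1 (Subtype.ext h)
    obtain ⟨k, hk⟩ := pow_unbounded_of_one_lt (1 / |(x : ℝ) - p|) hs1
    rw [div_lt_iff₀ hxp, ← hpow, lt_abs] at hk
    have := hmid k
    have := midFix_lt hbn hban han
    rcases hk with hk | hk <;> linarith

end

end RecDet

/-! ### Choice of the ratios. -/

namespace RecDet

open Classical in
/-- The exponents of the ratios of the left copies. -/
noncomputable def leftExponent (n : ℕ) : ℕ := if ∃ k, n = 4 ^ k then 8 ^ n else 1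

theorem leftExponent_four_pow (k : ℕ) : leftExponent (4 ^ k) = 8 ^ 4 ^ k := if_pos ⟨k, rfl⟩

theorem leftExponent_le (n : ℕ) : leftExponent n ≤ 8 ^ n := by
  unfold leftExponent
  split_ifs
  · exact le_rfl
  · exact Nat.one_le_pow _ _ (by norm_num)

theorem one_le_leftExponent (n : ℕ) : 1 ≤ leftExponent n := by
  unfold leftExponent
  split_ifs
  · exact Nat.one_le_pow _ _ (by norm_num)
  · exact le_rfl

theorem leftExponent_of_lt {k l : ℕ} (h1 : 4 ^ k < l) (h2 : l < 4 ^ (k + 1)) :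
    leftExponent l = 1 := by
  refine if_neg ?_
  rintro ⟨j, rfl⟩
  have := (Nat.pow_lt_pow_iff_right (by norm_num)).1 h1
  have := (Nat.pow_lt_pow_iff_right (by norm_num)).1 h2
  omega

theorem seven_mul_sum_eight_pow (m : ℕ) : 7 * ∑ l ∈ Finset.range m, 8 ^ l + 1 = 8 ^ m := by
  induction m with
  | zero => rfl
  | succ m ih =>
    rw [Finset.sum_range_succ, pow_succ]
    omega

theorem le_sum_eight_pow (m : ℕ) : m ≤ ∑ l ∈ Finset.range m, 8 ^ l := by
  calc m = ∑ _l ∈ Finset.range m, 1 := by simp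
    _ ≤ _ := Finset.sum_le_sum fun l _ => Nat.one_le_pow _ _ (by norm_num)

theorem sum_leftExponent_le (k j : ℕ) (hj : 4 ^ k + 1 + j ≤ 4 ^ (k + 1)) :
    ∑ l ∈ Finset.range (4 ^ k + 1 + j), leftExponent l ≤
      ∑ l ∈ Finset.range (4 ^ k), 8 ^ l + 8 ^ 4 ^ k + j := by
  induction j with
  | zero =>
    rw [add_zero, add_zero, Finset.sum_range_succ, leftExponent_four_pow]
    gcongr
    exact leftExponent_le _
  | succ j ih =>
    rw [← add_assoc, Finset.sum_range_succ, leftExponent_of_lt (k := k) (by omega) (by omega)]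
    have := ih (by omega)
    omega

/-- With `m = 4 ^ k`, the terms below `m` add up to at most `(8 ^ m - 1) / 7`, the term at `m` is `8
^ m`, and the remaining `2 * m - 1` terms are 1, as `3 * m` is below the next power of four. -/
theorem sum_leftExponent_lt (k : ℕ) :
    1 + ∑ l ∈ Finset.range (3 * 4 ^ k), leftExponent l < 2 * 8 ^ 4 ^ k := by
  have hpos : 0 < 4 ^ k := by positivity
  have h := sum_leftExponent_le k (2 * 4 ^ k - 1) (by rw [pow_succ]; omega)
  rw [show 4 ^ k + 1 + (2 * 4 ^ k - 1) = 3 * 4 ^ k by omega] at h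
  have h1 := seven_mul_sum_eight_pow (4 ^ k)
  have h2 := le_sum_eight_pow (4 ^ k)
  omega

theorem one_third_pow_le {p q : ℕ} (h : p ≤ q) : (1 / 3 : ℝ) ^ q ≤ (1 / 3) ^ p :=
  pow_le_pow_of_le_one (by norm_num) (by norm_num) h

theorem one_third_pow_lt {p q : ℕ} (h : p < q) : (1 / 3 : ℝ) ^ q < (1 / 3) ^ p :=
  pow_lt_pow_right_of_lt_one₀ (by norm_num) (by norm_num) h

/-- The doubling tower which witnesses the theorem. -/
noncomputable def solenoidTower : DoublingTower unitInterval :=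
  intervalTower (fun n => (1 / 3) ^ leftExponent n) (fun n => (1 / 3) ^ (2 * 8 ^ n))
    (fun n => by positivity)
    (fun n => one_third_pow_le ((leftExponent_le n).trans (by omega)))
    (fun n => (one_third_pow_le (one_le_leftExponent n)).trans (by norm_num))

theorem solenoidTower_a (n : ℕ) : solenoidTower.a n = (1 / 3) ^ leftExponent n := rfl

theorem solenoidTower_b (n : ℕ) : solenoidTower.b n = (1 / 3) ^ (2 * 8 ^ n) := rfl

theorem solenoidTower_a_lt (k : ℕ) :
    solenoidTower.a (4 ^ k) < 1 / 3 * ∏ l ∈ Finset.range (4 ^ k), solenoidTower.b l := by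
  simp only [solenoidTower_a, solenoidTower_b, leftExponent_four_pow, Finset.prod_pow_eq_pow_sum,
    ← Finset.mul_sum]
  rw [← pow_succ']
  have := seven_mul_sum_eight_pow (4 ^ k)
  have := le_sum_eight_pow (4 ^ k)
  have hpos : 0 < 4 ^ k := by positivity
  exact one_third_pow_lt (by omega)

theorem solenoidTower_b_lt (k : ℕ) :
    solenoidTower.b (4 ^ k) < 1 / 3 * ∏ l ∈ Finset.range (3 * 4 ^ k), solenoidTower.a l := by
  simp only [solenoidTower_a, solenoidTower_b, Finset.prod_pow_eq_pow_sum]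
  rw [← pow_succ']
  have := sum_leftExponent_lt k
  exact one_third_pow_lt (by omega)

theorem upperRdet_solenoidTower_le {x : unitInterval} (hx : x ∈ solenoidTower.solenoid 0) (k : ℕ) :
    upperRdet (solenoidTower.map 0) ⊤ x (solenoidTower.b (4 ^ k)) ≤ 16 * (1 / 2) ^ 4 ^ k := by
  refine (solenoidTower.upperRdet_le_of_lt hx (solenoidTower_b_lt k)).trans (le_of_eq ?_)
  -- The factor `2 ^ (-3 * m)` from `C_∞` outweighs `4 ^ m` from `C_1`, leaving `2 ^ (-m)`.
  generalize 4 ^ k = m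
  rw [one_div, inv_pow, show 3 * m + 1 = m + 2 * m + 1 by ring, pow_succ, pow_add, pow_mul']
  field_simp
  ring

theorem one_third_pow_properties {e : ℕ → ℕ} (he : StrictMono e) :
    (∀ k, 0 < (1 / 3 : ℝ) ^ e k) ∧ (StrictAnti fun k => (1 / 3 : ℝ) ^ e k) ∧
      Tendsto (fun k => (1 / 3 : ℝ) ^ e k) atTop (𝓝 0) :=
  ⟨fun k => by positivity, fun _ _ h => one_third_pow_lt (he h),
    (tendsto_pow_atTop_nhds_zero_of_lt_one (by norm_num) (by norm_num)).comp he.tendsto_atTop⟩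

theorem strictMono_four_pow : StrictMono fun k : ℕ => 4 ^ k :=
  pow_right_strictMono₀ (by norm_num)

theorem strictMono_eight_pow_four_pow : StrictMono fun k : ℕ => 8 ^ 4 ^ k :=
  (pow_right_strictMono₀ (by norm_num : 1 < 8)).comp strictMono_four_pow

/-! ### Upper and lower limits as the scale tends to 0. -/

section

variable {X : Type*} [MetricSpace X] [CompactSpace X] (f : X → X)

theorem limsup_lowerRdet_eq_one {x : X} {ε : ℕ → ℝ} (h0 : ∀ k, 0 < ε k)
    (hε : Tendsto ε atTop (𝓝 0)) (h : ∀ k, lowerRdet f ⊤ x (ε k) = 1) :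
    limsup (fun δ : ℝ => lowerRdet f ⊤ x δ) (𝓝[>] 0) = 1 := by
  have hε' : Tendsto ε atTop (𝓝[>] 0) :=
    tendsto_nhdsWithin_iff.2 ⟨hε, Eventually.of_forall h0⟩
  have hle : ∀ δ, lowerRdet f ⊤ x δ ≤ 1 := fun δ =>
    (lowerRdet_le_upperRdet f x δ).trans (upperRdet_le_one f x δ)
  have hbdd : IsBoundedUnder (· ≥ ·) (𝓝[>] (0 : ℝ)) fun δ => lowerRdet f ⊤ x δ :=
    isBoundedUnder_of ⟨0, fun δ => lowerRdet_nonneg f x δ⟩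
  refine le_antisymm (limsup_le_of_le hbdd.isCoboundedUnder_le (Eventually.of_forall hle)) ?_
  exact le_limsup_of_frequently_le
    (hε'.frequently (Frequently.of_forall fun k => (h k).ge)) (isBoundedUnder_of ⟨1, hle⟩)

theorem liminf_upperRdet_eq_zero {x : X} {ε : ℕ → ℝ} (h0 : ∀ k, 0 < ε k)
    (hε : Tendsto ε atTop (𝓝 0)) (h : Tendsto (fun k => upperRdet f ⊤ x (ε k)) atTop (𝓝 0)) :
    liminf (fun δ : ℝ => upperRdet f ⊤ x δ) (𝓝[>] 0) = 0 := by
  have hε' : Tendsto ε atTop (𝓝[>] 0) :=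
    tendsto_nhdsWithin_iff.2 ⟨hε, Eventually.of_forall h0⟩
  have hge : ∀ δ, 0 ≤ upperRdet f ⊤ x δ := fun δ =>
    (lowerRdet_nonneg f x δ).trans (lowerRdet_le_upperRdet f x δ)
  have hbdd : IsBoundedUnder (· ≤ ·) (𝓝[>] (0 : ℝ)) fun δ => upperRdet f ⊤ x δ :=
    isBoundedUnder_of ⟨1, fun δ => upperRdet_le_one f x δ⟩
  refine le_antisymm (le_of_forall_pos_le_add fun c hc => ?_)
    (le_liminf_of_le hbdd.isCoboundedUnder_ge (Eventually.of_forall hge))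
  rw [zero_add]
  exact liminf_le_of_frequently_le
    (hε'.frequently ((h.eventually (gt_mem_nhds hc)).mono fun k hk => hk.le).frequently)
    (isBoundedUnder_of ⟨0, hge⟩)

end

end RecDet

theorem theorem1p3 :
    ∃ (f : unitInterval → unitInterval) (C : Set unitInterval) (ε ε' : ℕ → ℝ),
      Continuous f ∧
      ¬ RecDet.IsLiYorkeChaotic f ∧
      RecDet.IsOfTypeTwoInfty f ∧
      (C.Infinite ∧ RecDet.IsMinimalSet f C) ∧
      (∀ D : Set unitInterval, D.Infinite → RecDet.IsMinimalSet f D → D = C) ∧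
      ((∀ k, 0 < ε k) ∧ StrictAnti ε ∧ Tendsto ε atTop (𝓝 0)) ∧
      ((∀ k, 0 < ε' k) ∧ StrictAnti ε' ∧ Tendsto ε' atTop (𝓝 0)) ∧
      ∀ x ∈ C,
        (∀ k, RecDet.RdetExistsEq f ⊤ x (ε k) 1) ∧
        Tendsto (fun k => RecDet.upperRdet f ⊤ x (ε' k)) atTop (𝓝 0) ∧
        limsup (fun δ : ℝ => RecDet.lowerRdet f ⊤ x δ) (𝓝[>] 0) = 1 ∧
        liminf (fun δ : ℝ => RecDet.upperRdet f ⊤ x δ) (𝓝[>] 0) = 0 := by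
  let T := RecDet.solenoidTower
  have hε : (∀ k, 0 < T.a (4 ^ k)) ∧ (StrictAnti fun k => T.a (4 ^ k)) ∧
      Tendsto (fun k => T.a (4 ^ k)) atTop (𝓝 0) := by
    simp only [T, RecDet.solenoidTower_a, RecDet.leftExponent_four_pow]
    exact RecDet.one_third_pow_properties RecDet.strictMono_eight_pow_four_pow
  have hε' : (∀ k, 0 < T.b (4 ^ k)) ∧ (StrictAnti fun k => T.b (4 ^ k)) ∧
      Tendsto (fun k => T.b (4 ^ k)) atTop (𝓝 0) :=
    RecDet.one_third_pow_properties (RecDet.strictMono_eight_pow_four_pow.const_mul two_pos)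
  refine ⟨T.map 0, T.solenoid 0, fun k => T.a (4 ^ k), fun k => T.b (4 ^ k),
    T.continuous_map 0, T.not_isLiYorkeChaotic 0, T.isOfTypeTwoInfty 0,
    ⟨T.infinite_solenoid 0, T.isMinimalSet_solenoid 0⟩,
    fun D hD hmin => T.eq_solenoid_of_isMinimalSet 0 hD hmin, hε, hε', fun x hx => ?_⟩
  have h1 : ∀ k, RecDet.RdetExistsEq (T.map 0) ⊤ x (T.a (4 ^ k)) 1 := fun k =>
    T.rdetExistsEq_one_of_lt hx (RecDet.solenoidTower_a_lt k)
  have h2 : Tendsto (fun k => RecDet.upperRdet (T.map 0) ⊤ x (T.b (4 ^ k))) atTop (𝓝 0) := by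
    refine squeeze_zero (fun k => (RecDet.lowerRdet_nonneg _ x _).trans
      (RecDet.lowerRdet_le_upperRdet _ x _)) (RecDet.upperRdet_solenoidTower_le hx) ?_
    rw [← mul_zero (16 : ℝ)]
    exact ((tendsto_pow_atTop_nhds_zero_of_lt_one (by norm_num) (by norm_num)).comp
      RecDet.strictMono_four_pow.tendsto_atTop).const_mul 16
  exact ⟨h1, h2, RecDet.limsup_lowerRdet_eq_one _ hε.1 hε.2.2 fun k => (h1 k).1,
    RecDet.liminf_upperRdet_eq_zero _ hε'.1 hε'.2.2 h2⟩
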